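/- Let $(\Omega,\mathcal A,\mathbb P)$ be an atomless probability space, i.e. every $A\in\mathcal A$ with $\mathbb P(A)>0$ contains some $B\in\mathcal A$ with $0<\mathbb P(B)<\mathbb P(A)$. Let $d$ be a natural number, and let $L^2(\Omega,\mathbb P;\mathbb R^d)$ be the Hilbert space of (a.s. classes of) square-integrable $\mathbb R^d$-valued random variables, where $\mathbb R^d$ carries the Euclidean norm. Let $F:L^2(\Omega,\mathbb P;\mathbb R^d)\to\mathbb R$ be law invariant, i.e. $F(X)=F(Y)$ whenever $X$ and $Y$ have the same law. When $F$ is Fréchet differentiable at $X$, let $DF(X)\in L^2(\Omega,\mathbb P;\mathbb R^d)$ denote its Fréchet derivative, identified through the Riesz representation theorem: $F(X+Y)=F(X)+\mathbb E[DF(X)\cdot Y]+o(\|Y\|_2)$ as $\|Y\|_2\to0$. Suppose that $F$ is Fréchet differentiable at some $X\in L^2(\Omega,\mathbb P;\mathbb R^d)$, and let $\mu$ be the law of $X$. Then there is a measurable function $g:\mathbb R^d\to\mathbb R^d$ with $g\in L^2(\mathbb R^d,\mu;\mathbb R^d)$ such that $DF(X)=g(X)$ almost surely and, for every $\tilde X\in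 L^2(\Omega,\mathbb P;\mathbb R^d)$ with law $\mu$, $F$ is Fréchet differentiable at $\tilde X$ with $DF(\tilde X)=g(\tilde X)$ almost surely. -/

import Mathlib

open MeasureTheory ProbabilityTheory
open scoped ENNReal Gradient

/-- A measure is atomless if every measurable set of positive measure contains a measurable
subset of strictly smaller positive measure. (This is stronger than the vanishing of the measure
on singletons.) -/
def IsAtomless {Ω : Type*} [MeasurableSpace Ω] (P : Measure Ω) : Prop :=
  ∀ s : Set Ω, MeasurableSet s → 0 < P s →
    ∃ t : Set Ω, t ⊆ s ∧ MeasurableSet t ∧ 0 < P t ∧ P t < P s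

/-- A function on the square-integrable `ℝ^d`-valued random variables is law invariant if its
value at `X` depends only on the law of `X`. -/
def LawInvariant {Ω : Type*} [MeasurableSpace Ω] {P : Measure Ω} {d : ℕ}
    (F : Lp (EuclideanSpace ℝ (Fin d)) 2 P → ℝ) : Prop :=
  ∀ X Y : Lp (EuclideanSpace ℝ (Fin d)) 2 P, IdentDistrib X Y P P → F X = F Y

/-!
An atomless space contains an increasing family of events of all possible measures. Hence it
carries every law on a standard Borel space, even jointly with a prescribed countably valued
variable. Discretising with cells of small diameter: if `X` and `X'` have the same law, then every
pair `(X', Y')` has a copy `(X₁, Y₁)` in which `X₁` is uniformly close to `X`.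

Being the gradient is therefore a property of the joint law: let `G` be the gradient of `F` at `X`
and let `(X, G)` and `(X', G')` have the same law. For a direction `Y'`, a copy `(X₁, G₁, Y₁)` of
`(X', G', Y')` with `(X₁, G₁)` close to `(X, G)` turns the expansion of `F` at `X` into the
expansion at `X'` with gradient `G'`.

Now realise two copies `(X₁, G₁)` and `(X₁, G₂)` of `(X, G)` with `G₁` and `G₂` conditionally
independent given `X₁`. Both `G₁` and `G₂` are the gradient at `X₁`, so they agree, and the
conditional law of `G` given `X` is a Dirac mass: `G = g(X)`. Finally `(X, g(X))` and
`(X', g(X'))` have the same law whenever `X` and `X'` do.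
-/

section Nest

variable {Ω : Type*} [MeasurableSpace Ω] {P : Measure Ω} {𝒞 𝒟 : Set (Set Ω)}

/-- A nest is a family of measurable sets ordered by inclusion in which the measure determines
the set; equivalently, inclusion of its members amounts to comparison of their measures. Nests are
used to find a set of every prescribed measure in an atomless space. -/
def IsNest (P : Measure Ω) (𝒞 : Set (Set Ω)) : Prop :=
  (∀ s ∈ 𝒞, MeasurableSet s) ∧ ∀ s ∈ 𝒞, ∀ t ∈ 𝒞, P s ≤ P t → s ⊆ t

theorem IsNest.mono (h𝒟 : IsNest P 𝒟) (h : 𝒞 ⊆ 𝒟) : IsNest P 𝒞 :=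
  ⟨fun s hs => h𝒟.1 s (h hs), fun s hs t ht => h𝒟.2 s (h hs) t (h ht)⟩

theorem IsNest.insert (h𝒞 : IsNest P 𝒞) {s : Set Ω} (hs : MeasurableSet s)
    (h : ∀ t ∈ 𝒞, t ⊆ s ∧ P t < P s ∨ s ⊆ t ∧ P s < P t) : IsNest P (insert s 𝒞) := by
  refine ⟨Set.forall_mem_insert.2 ⟨hs, h𝒞.1⟩, ?_⟩
  rintro t (rfl | ht) u (rfl | hu) htu
  · exact subset_rfl
  · exact (h u hu).elim (fun h => absurd h.2 htu.not_gt) And.left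
  · exact (h t ht).elim And.left (fun h => absurd h.2 htu.not_gt)
  · exact h𝒞.2 t ht u hu htu

theorem IsNest.image_compl [IsFiniteMeasure P] (h𝒞 : IsNest P 𝒞) : IsNest P (compl '' 𝒞) := by
  refine ⟨Set.forall_mem_image.2 fun s hs => (h𝒞.1 s hs).compl, ?_⟩
  rintro _ ⟨s, hs, rfl⟩ _ ⟨t, ht, rfl⟩ h
  refine Set.compl_subset_compl.2 (h𝒞.2 t ht s hs ?_)
  rw [← compl_compl t, ← compl_compl s, measure_compl (h𝒞.1 t ht).compl (measure_ne_top _ _),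
    measure_compl (h𝒞.1 s hs).compl (measure_ne_top _ _)]
  exact tsub_le_tsub_left h _

theorem IsNest.sUnion_of_isChain {S : Set (Set (Set Ω))} (hS : IsChain (· ⊆ ·) S)
    (h : ∀ 𝒞 ∈ S, IsNest P 𝒞) : IsNest P (⋃₀ S) := by
  refine ⟨fun s ⟨𝒞, h𝒞, hs⟩ => (h 𝒞 h𝒞).1 s hs, ?_⟩
  rintro s ⟨𝒞, h𝒞, hs⟩ t ⟨𝒟, h𝒟, ht⟩
  rcases hS.total h𝒞 h𝒟 with hle | hle
  · exact (h 𝒟 h𝒟).2 s (hle hs) t ht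
  · exact (h 𝒞 h𝒞).2 s hs t (hle ht)

theorem IsNest.exists_countable_sUnion_eq (h𝒞 : IsNest P 𝒞) :
    ∃ 𝒯 ⊆ 𝒞, 𝒯.Countable ∧ ⋃₀ 𝒯 = ⋃₀ 𝒞 := by
  by_cases hmax : ∃ s ∈ 𝒞, ∀ t ∈ 𝒞, P t ≤ P s
  · obtain ⟨s, hs, hmax⟩ := hmax
    refine ⟨{s}, Set.singleton_subset_iff.2 hs, Set.countable_singleton s, ?_⟩
    rw [Set.sUnion_singleton]
    exact (Set.subset_sUnion_of_mem hs).antisymm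
      (Set.sUnion_subset fun t ht => h𝒞.2 t ht s hs (hmax t ht))
  push Not at hmax
  rcases 𝒞.eq_empty_or_nonempty with rfl | hne
  · exact ⟨∅, subset_rfl, Set.countable_empty, rfl⟩
  obtain ⟨u, -, hu, hmem⟩ := exists_seq_tendsto_sSup (hne.image P) (OrderTop.bddAbove _)
  choose s hs hsu using hmem
  refine ⟨Set.range s, Set.range_subset_iff.2 hs, Set.countable_range s,
    (Set.sUnion_mono (Set.range_subset_iff.2 hs)).antisymm (Set.sUnion_subset fun t ht => ?_)⟩
  obtain ⟨v, hv, htv⟩ := hmax t ht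
  obtain ⟨n, hn⟩ := (hu.eventually_const_lt
    (htv.trans_le (le_sSup (Set.mem_image_of_mem P hv)))).exists
  exact (h𝒞.2 t ht (s n) (hs n) (hsu n ▸ hn.le)).trans
    (Set.subset_sUnion_of_mem (Set.mem_range_self n))

theorem IsNest.measurableSet_sUnion (h𝒞 : IsNest P 𝒞) : MeasurableSet (⋃₀ 𝒞) := by
  obtain ⟨𝒯, h𝒯, hcount, heq⟩ := h𝒞.exists_countable_sUnion_eq
  exact heq ▸ .sUnion hcount fun s hs => h𝒞.1 s (h𝒯 hs)

theorem IsNest.measure_sUnion_le (h𝒞 : IsNest P 𝒞) {a : ℝ≥0∞} (h : ∀ s ∈ 𝒞, P s ≤ a) :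
    P (⋃₀ 𝒞) ≤ a := by
  obtain ⟨𝒯, h𝒯, hcount, heq⟩ := h𝒞.exists_countable_sUnion_eq
  have hdir : DirectedOn (· ⊆ ·) 𝒯 := IsChain.directedOn fun s hs t ht _ =>
    (le_total (P s) (P t)).imp (h𝒞.2 s (h𝒯 hs) t (h𝒯 ht)) (h𝒞.2 t (h𝒯 ht) s (h𝒯 hs))
  rw [← heq, Set.sUnion_eq_biUnion, measure_biUnion_eq_iSup hcount hdir]
  exact iSup₂_le fun s hs => h s (h𝒯 hs)

theorem IsNest.measurableSet_sInter [IsFiniteMeasure P] (h𝒞 : IsNest P 𝒞) :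
    MeasurableSet (⋂₀ 𝒞) :=
  Set.sInter_eq_compl_sUnion_compl 𝒞 ▸ h𝒞.image_compl.measurableSet_sUnion.compl

theorem IsNest.le_measure_sInter [IsFiniteMeasure P] (h𝒞 : IsNest P 𝒞) {a : ℝ≥0∞}
    (ha : a ≤ P .univ) (h : ∀ s ∈ 𝒞, a ≤ P s) : a ≤ P (⋂₀ 𝒞) := by
  have hle : P (⋃₀ (compl '' 𝒞)) ≤ P .univ - a :=
    h𝒞.image_compl.measure_sUnion_le (Set.forall_mem_image.2 fun s hs => by
      rw [measure_compl (h𝒞.1 s hs) (measure_ne_top _ _)]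
      exact tsub_le_tsub_left (h s hs) _)
  rw [Set.sInter_eq_compl_sUnion_compl,
    measure_compl h𝒞.image_compl.measurableSet_sUnion (measure_ne_top _ _)]
  exact (ENNReal.sub_sub_cancel (measure_ne_top _ _) ha).ge.trans (tsub_le_tsub_left hle _)

theorem IsAtomless.exists_measure_between (hP : IsAtomless P) {s t : Set Ω} (hs : MeasurableSet s)
    (ht : MeasurableSet t) (hst : s ⊆ t) (hPs : P s ≠ ∞) (hlt : P s < P t) :
    ∃ u, s ⊆ u ∧ u ⊆ t ∧ MeasurableSet u ∧ P s < P u ∧ P u < P t := by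
  have hadd (v : Set Ω) (hv : v ⊆ t \ s) (hvm : MeasurableSet v) : P (s ∪ v) = P s + P v :=
    measure_union (Set.disjoint_sdiff_right.mono_right hv) hvm
  obtain ⟨v, hv, hvm, hpos, hvlt⟩ := hP (t \ s) (ht.diff hs)
    (by rwa [measure_sdiff hst hs.nullMeasurableSet hPs, tsub_pos_iff_lt])
  refine ⟨s ∪ v, Set.subset_union_left, Set.union_subset hst (hv.trans Set.sdiff_subset),
    hs.union hvm, ?_, ?_⟩
  · rw [hadd v hv hvm]
    exact ENNReal.lt_add_right hPs hpos.ne'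
  · rw [hadd v hv hvm, ← Set.union_sdiff_cancel hst, hadd _ subset_rfl (ht.diff hs)]
    exact ENNReal.add_lt_add_left hPs hvlt

theorem IsAtomless.exists_mem_measure_eq_of_maximal [IsFiniteMeasure P] (hP : IsAtomless P)
    (h𝒞 : Maximal (IsNest P) 𝒞) {a : ℝ≥0∞} (ha : a ≤ P .univ) : ∃ s ∈ 𝒞, P s = a := by
  by_contra! hne
  let lower := {s ∈ 𝒞 | P s < a}
  let upper := {s ∈ 𝒞 | a < P s}
  have hlower : IsNest P lower := h𝒞.prop.mono (Set.sep_subset _ _)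
  have hupper : IsNest P upper := h𝒞.prop.mono (Set.sep_subset _ _)
  have hsub : ⋃₀ lower ⊆ ⋂₀ upper := Set.sUnion_subset fun s hs => Set.subset_sInter fun t ht =>
    h𝒞.prop.2 s hs.1 t ht.1 (hs.2.trans ht.2).le
  have hleL {t : Set Ω} (ht : t ∈ 𝒞) (hta : P t < a) : t ⊆ ⋃₀ lower :=
    Set.subset_sUnion_of_mem ⟨ht, hta⟩
  have hUle {t : Set Ω} (ht : t ∈ 𝒞) (hta : a < P t) : ⋂₀ upper ⊆ t :=
    Set.sInter_subset_of_mem ⟨ht, hta⟩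
  have hmem {s : Set Ω} (hs : MeasurableSet s) (hls : ⋃₀ lower ⊆ s) (hsu : s ⊆ ⋂₀ upper)
      (hl : ∀ t ∈ lower, P t < P s) (hu : ∀ t ∈ upper, P s < P t) : s ∈ 𝒞 :=
    h𝒞.mem_of_prop_insert <| h𝒞.prop.insert hs fun t ht => (hne t ht).lt_or_gt.imp
      (fun hta => ⟨(hleL ht hta).trans hls, hl t ⟨ht, hta⟩⟩)
      (fun hta => ⟨hsu.trans (hUle ht hta), hu t ⟨ht, hta⟩⟩)
  have hPl : P (⋃₀ lower) ≤ a := hlower.measure_sUnion_le fun s hs => hs.2.le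
  have hPu : a ≤ P (⋂₀ upper) := hupper.le_measure_sInter ha fun s hs => hs.2.le
  by_cases hPl' : P (⋃₀ lower) = a
  · exact hne _ (hmem hlower.measurableSet_sUnion subset_rfl hsub
      (fun t ht => ht.2.trans_eq hPl'.symm) (fun t ht => hPl'.trans_lt ht.2)) hPl'
  obtain ⟨s, hls, hsu, hs, hlt, hgt⟩ := hP.exists_measure_between hlower.measurableSet_sUnion
    hupper.measurableSet_sInter hsub (measure_ne_top _ _) ((hPl.lt_of_ne hPl').trans_le hPu)
  have hs𝒞 : s ∈ 𝒞 := hmem hs hls hsu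
    (fun t ht => (measure_mono (hleL ht.1 ht.2)).trans_lt hlt)
    (fun t ht => hgt.trans_le (measure_mono (hUle ht.1 ht.2)))
  rcases (hne s hs𝒞).lt_or_gt with hsa | hsa
  · exact (measure_mono (hleL hs𝒞 hsa)).not_gt hlt
  · exact (measure_mono (hUle hs𝒞 hsa)).not_gt hgt

theorem IsAtomless.exists_monotone_measure_eq [IsFiniteMeasure P] (hP : IsAtomless P) :
    ∃ A : ℝ≥0∞ → Set Ω, Monotone A ∧ (∀ a, MeasurableSet (A a)) ∧
      ∀ a, P (A a) = min a (P .univ) := by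
  obtain ⟨𝒞, h𝒞⟩ := zorn_subset {𝒞 | IsNest P 𝒞} fun S hS hchain =>
    ⟨⋃₀ S, .sUnion_of_isChain hchain hS, fun _ => Set.subset_sUnion_of_mem⟩
  choose A hA hPA using fun a : ℝ≥0∞ =>
    hP.exists_mem_measure_eq_of_maximal h𝒞 (min_le_right a (P .univ))
  refine ⟨A, fun a b hab => h𝒞.prop.2 _ (hA a) _ (hA b) ?_, fun a => h𝒞.prop.1 _ (hA a), hPA⟩
  rw [hPA, hPA]
  exact min_le_min_right _ hab

end Nest

section Representation

open unitInterval

variable {Ω : Type*} [MeasurableSpace Ω] {P : Measure Ω}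

theorem IsAtomless.restrict (hP : IsAtomless P) {s : Set Ω} (hs : MeasurableSet s) :
    IsAtomless (P.restrict s) := by
  intro t ht hpos
  rw [Measure.restrict_apply ht] at hpos
  obtain ⟨u, hu, hum, hu0, hult⟩ := hP _ (ht.inter hs) hpos
  refine ⟨u, hu.trans Set.inter_subset_left, hum, ?_⟩
  rw [Measure.restrict_apply hum, Measure.restrict_apply ht,
    Set.inter_eq_left.2 (hu.trans Set.inter_subset_right)]
  exact ⟨hu0, hult⟩

theorem IsAtomless.smul (hP : IsAtomless P) {c : ℝ≥0∞} (hc : c ≠ ∞) : IsAtomless (c • P) := by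
  intro s hs hpos
  simp only [Measure.smul_apply, smul_eq_mul] at hpos ⊢
  have hc0 : c ≠ 0 := left_ne_zero_of_mul hpos.ne'
  obtain ⟨t, hts, ht, ht0, htlt⟩ := hP s hs (right_ne_zero_of_mul hpos.ne').bot_lt
  exact ⟨t, hts, ht, ENNReal.mul_pos hc0 ht0.ne', ENNReal.mul_lt_mul_right hc0 hc htlt⟩

theorem IsAtomless.exists_uniform [IsProbabilityMeasure P] (hP : IsAtomless P) :
    ∃ U : Ω → I, Measurable U ∧ P.map U = volume := by
  obtain ⟨A, hmono, hA, hPA⟩ := hP.exists_monotone_measure_eq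
  let q : ℕ → I := TopologicalSpace.denseSeq I
  let B : I → Set Ω := fun x => A (.ofReal x)
  have hPB (x : I) : P (B x) = .ofReal x := by
    rw [hPA, measure_univ, min_eq_left (ENNReal.ofReal_le_one.2 x.2.2)]
  -- `U ω` is the level at which the increasing sets `B x` start to contain `ω`; taking the supremum
  -- over a dense sequence of levels only makes it measurable.
  let U : Ω → I := fun ω => ⨆ n, (B (q n))ᶜ.indicator (fun _ => q n) ω
  have hU : Measurable U := .iSup fun n => measurable_const.indicator (hA _).compl
  refine ⟨U, hU, Measure.ext_of_Iic _ _ fun x => ?_⟩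
  have hmem (ω : Ω) : U ω ≤ x ↔ ∀ n, x < q n → ω ∈ B (q n) := by
    refine iSup_le_iff.trans (forall_congr' fun n => ?_)
    by_cases hω : ω ∈ B (q n) <;> simp [hω]
  rw [Measure.map_apply hU measurableSet_Iic, unitInterval.volume_Iic]
  refine le_antisymm ?_ ?_
  · by_contra! hlt
    let y : I := ⟨P.real (U ⁻¹' .Iic x), measureReal_nonneg, measureReal_le_one⟩
    obtain ⟨_, ⟨n, rfl⟩, hxn, hny⟩ := (TopologicalSpace.denseRange_denseSeq I).exists_between
      (show x < y from (ENNReal.ofReal_lt_iff_lt_toReal x.2.1 (measure_ne_top _ _)).1 hlt)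
    have hle : P (U ⁻¹' .Iic x) ≤ P (B (q n)) := measure_mono fun ω hω => (hmem ω).1 hω n hxn
    rw [hPB] at hle
    exact hle.not_gt ((ENNReal.ofReal_lt_iff_lt_toReal (q n).2.1 (measure_ne_top _ _)).2 hny)
  · rw [← hPB]
    refine measure_mono fun ω hω => (hmem ω).2 fun n hn => hmono ?_ hω
    exact ENNReal.ofReal_le_ofReal hn.le

theorem IsAtomless.exists_map_eq [IsFiniteMeasure P] (hP : IsAtomless P) {E : Type*}
    [MeasurableSpace E] [StandardBorelSpace E] [Nonempty E] {ν : Measure E}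
    (hν : ν .univ = P .univ) : ∃ Z : Ω → E, Measurable Z ∧ P.map Z = ν := by
  by_cases hP0 : P .univ = 0
  · have : P = 0 := Measure.measure_univ_eq_zero.1 hP0
    have : ν = 0 := Measure.measure_univ_eq_zero.1 (hν.trans hP0)
    subst_vars
    exact ⟨fun _ => Classical.arbitrary E, measurable_const, Measure.map_zero _⟩
  set c := P .univ
  have hc : c ≠ ∞ := measure_ne_top P .univ
  have : IsProbabilityMeasure (c⁻¹ • P) := ⟨ENNReal.inv_mul_cancel hP0 hc⟩
  have : IsProbabilityMeasure (c⁻¹ • ν) := ⟨by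
    rw [Measure.smul_apply, hν]
    exact ENNReal.inv_mul_cancel hP0 hc⟩
  obtain ⟨U, hU, hPU⟩ := (hP.smul (ENNReal.inv_ne_top.2 hP0)).exists_uniform
  obtain ⟨f, hf, hfν⟩ := (c⁻¹ • ν).exists_measurable_map_eq
  refine ⟨f ∘ U, hf.comp hU, ?_⟩
  have h : c⁻¹ • P.map (f ∘ U) = c⁻¹ • ν := by
    rw [← Measure.map_smul, ← Measure.map_map hf hU, hPU, hfν]
  simpa only [smul_smul, ENNReal.mul_inv_cancel hP0 hc, one_smul] using congrArg (c • ·) h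

theorem restrict_map_prodMk {ι E : Type*} [MeasurableSpace ι] [MeasurableSingletonClass ι]
    [MeasurableSpace E] {c : Ω → ι} {Z : Ω → E} (hc : Measurable c) (hZ : Measurable Z) (i : ι) :
    (P.map fun ω => (c ω, Z ω)).restrict (Prod.fst ⁻¹' {i}) =
      ((P.restrict (c ⁻¹' {i})).map Z).map (Prod.mk i) := by
  have hi : MeasurableSet (c ⁻¹' {i}) := hc (measurableSet_singleton i)
  rw [Measure.restrict_map (hc.prodMk hZ) (measurable_fst (measurableSet_singleton i)),
    Measure.map_map measurable_prodMk_left hZ]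
  refine Measure.map_congr ((ae_restrict_iff' hi).2 (.of_forall fun ω hω => ?_))
  exact congrArg (·, Z ω) hω

theorem IsAtomless.exists_identDistrib_prodMk [IsFiniteMeasure P] (hP : IsAtomless P)
    {Ω' ι E : Type*} [MeasurableSpace Ω'] {P' : Measure Ω'} [Countable ι] [MeasurableSpace ι]
    [MeasurableSingletonClass ι] [MeasurableSpace E] [StandardBorelSpace E] [Nonempty E]
    {c : Ω → ι} {c' : Ω' → ι} {Z' : Ω' → E} (hc : Measurable c) (hc' : Measurable c')
    (hZ' : Measurable Z') (h : IdentDistrib c c' P P') :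
    ∃ Z : Ω → E, Measurable Z ∧
      IdentDistrib (fun ω => (c ω, Z ω)) (fun ω => (c' ω, Z' ω)) P P' := by
  have hpiece (i : ι) : ∃ Z : Ω → E, Measurable Z ∧
      (P.restrict (c ⁻¹' {i})).map Z = (P'.restrict (c' ⁻¹' {i})).map Z' := by
    refine (hP.restrict (hc (measurableSet_singleton i))).exists_map_eq ?_
    rw [Measure.map_apply hZ' .univ, Set.preimage_univ, Measure.restrict_apply_univ,
      Measure.restrict_apply_univ, h.measure_mem_eq (measurableSet_singleton i)]
  choose Z hZ hmap using hpiece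
  let W : Ω → E := fun ω => Z (c ω) ω
  have hW : Measurable W :=
    (measurable_from_prod_countable_right (f := fun p : ι × Ω => Z p.1 p.2) hZ).comp
      (hc.prodMk measurable_id)
  refine ⟨W, hW, (hc.prodMk hW).aemeasurable, (hc'.prodMk hZ').aemeasurable, ?_⟩
  refine Measure.ext_of_iUnion_eq_univ (s := fun i : ι => Prod.fst ⁻¹' {i})
    (Set.iUnion_eq_univ_iff.2 fun p => ⟨p.1, rfl⟩) fun i => ?_
  have hWZ : W =ᵐ[P.restrict (c ⁻¹' {i})] Z i :=
    (ae_restrict_iff' (hc (measurableSet_singleton i))).2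
      (.of_forall fun ω hω => congrArg (Z · ω) hω)
  rw [restrict_map_prodMk hc hW, restrict_map_prodMk hc' hZ', Measure.map_congr hWZ, hmap]

end Representation

section Coupling

variable {Ω Ω' : Type*} [MeasurableSpace Ω] [MeasurableSpace Ω'] {P : Measure Ω}
  {P' : Measure Ω'}

theorem exists_measurable_nat_forall_dist_le (E : Type*) [PseudoMetricSpace E]
    [TopologicalSpace.SeparableSpace E] [MeasurableSpace E] [OpensMeasurableSpace E]
    {ε : ℝ} (hε : 0 < ε) :
    ∃ q : E → ℕ, Measurable q ∧ ∀ x y, q x = q y → dist x y ≤ ε := by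
  classical
  rcases isEmpty_or_nonempty E with hE | hE
  · exact ⟨fun _ => 0, measurable_const, fun x => (hE.false x).elim⟩
  let r : ℕ → E := TopologicalSpace.denseSeq E
  have hex (x : E) : ∃ n, dist x (r n) < ε / 2 :=
    (TopologicalSpace.denseRange_denseSeq E).exists_dist_lt x (half_pos hε)
  refine ⟨fun x => Nat.find (hex x), measurable_find hex fun n => ?_, fun x y hxy => ?_⟩
  · exact measurableSet_lt (by fun_prop) measurable_const
  · have hy : dist y (r (Nat.find (hex x))) < ε / 2 := by
      rw [show Nat.find (hex x) = Nat.find (hex y) from hxy]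
      exact Nat.find_spec (hex y)
    exact (dist_triangle_right _ _ _).trans
      ((add_lt_add (Nat.find_spec (hex x)) hy).trans_eq (add_halves ε)).le

theorem IsAtomless.exists_identDistrib_dist_le [IsFiniteMeasure P] (hP : IsAtomless P)
    {E E' : Type*} [PseudoMetricSpace E] [TopologicalSpace.SeparableSpace E] [MeasurableSpace E]
    [OpensMeasurableSpace E] [StandardBorelSpace E] [Nonempty E] [MeasurableSpace E']
    [StandardBorelSpace E'] [Nonempty E'] {X : Ω → E} {X' : Ω' → E} {Y' : Ω' → E'}
    (hX : Measurable X) (hX' : Measurable X') (hY' : Measurable Y') (h : IdentDistrib X X' P P')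
    {ε : ℝ} (hε : 0 < ε) :
    ∃ (X₁ : Ω → E) (Y₁ : Ω → E'), Measurable X₁ ∧ Measurable Y₁ ∧
      IdentDistrib (fun ω => (X₁ ω, Y₁ ω)) (fun ω => (X' ω, Y' ω)) P P' ∧
      ∀ᵐ ω ∂P, dist (X₁ ω) (X ω) ≤ ε := by
  obtain ⟨q, hq, hqε⟩ := exists_measurable_nat_forall_dist_le E hε
  obtain ⟨Z, hZ, hid⟩ := hP.exists_identDistrib_prodMk (hq.comp hX) (hq.comp hX')
    (hX'.prodMk hY') (h.comp hq)
  refine ⟨fun ω => (Z ω).1, fun ω => (Z ω).2, hZ.fst, hZ.snd, hid.comp measurable_snd, ?_⟩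
  have hcell : MeasurableSet {p : ℕ × E × E' | p.1 = q p.2.1} :=
    measurableSet_eq_fun measurable_fst (hq.comp (measurable_fst.comp measurable_snd))
  filter_upwards [hid.symm.ae_snd hcell (.of_forall fun _ => rfl)] with ω hω
  exact hqε _ _ (Eq.symm hω)

end Coupling

section Lp

variable {Ω Ω' : Type*} [MeasurableSpace Ω] [MeasurableSpace Ω'] {P : Measure Ω}
  {P' : Measure Ω'} {E : Type*} [NormedAddCommGroup E] {p : ℝ≥0∞}

theorem norm_sub_le_of_ae_dist_le [IsFiniteMeasure P] {X Y : Lp E p P} {ε : ℝ} (hε : 0 ≤ ε)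
    (h : ∀ᵐ ω ∂P, dist (X ω) (Y ω) ≤ ε) :
    ‖X - Y‖ ≤ measureUnivNNReal P ^ p.toReal⁻¹ * ε := by
  refine Lp.norm_le_of_ae_bound hε ?_
  filter_upwards [h, Lp.coeFn_sub X Y] with ω hω hsub
  rwa [hsub, Pi.sub_apply, ← dist_eq_norm]

variable [MeasurableSpace E] [BorelSpace E]

theorem measurable_Lp_coeFn (X : Lp E p P) : Measurable X :=
  (Lp.stronglyMeasurable X).measurable

theorem norm_eq_of_identDistrib {X : Lp E p P} {X' : Lp E p P'} (h : IdentDistrib X X' P P') :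
    ‖X‖ = ‖X'‖ := by
  rw [Lp.norm_def, Lp.norm_def, h.eLpNorm_eq]

theorem identDistrib_toLp_prodMk {p : ℝ≥0∞} {X Y : Ω → E} (hX : MemLp X p P) (hY : MemLp Y p P) :
    IdentDistrib (fun ω => (X ω, Y ω)) (fun ω => (hX.toLp X ω, hY.toLp Y ω)) P P :=
  .of_ae_eq (hX.aestronglyMeasurable.aemeasurable.prodMk hY.aestronglyMeasurable.aemeasurable)
    (hX.coeFn_toLp.symm.prodMk hY.coeFn_toLp.symm)

variable [SecondCountableTopology E]

theorem identDistrib_add {X Y : Lp E p P} {X' Y' : Lp E p P'}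
    (h : IdentDistrib (fun ω => (X ω, Y ω)) (fun ω => (X' ω, Y' ω)) P P') :
    IdentDistrib (X + Y : Lp E p P) (X' + Y' : Lp E p P') P P' :=
  (IdentDistrib.of_ae_eq (measurable_Lp_coeFn _).aemeasurable (Lp.coeFn_add X Y)).trans <|
    (h.comp (measurable_fst.add measurable_snd)).trans
      (IdentDistrib.of_ae_eq (measurable_Lp_coeFn _).aemeasurable (Lp.coeFn_add X' Y')).symm

theorem inner_eq_of_identDistrib [InnerProductSpace ℝ E] {X Y : Lp E 2 P} {X' Y' : Lp E 2 P'}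
    (h : IdentDistrib (fun ω => (X ω, Y ω)) (fun ω => (X' ω, Y' ω)) P P') :
    inner ℝ X Y = inner ℝ X' Y' := by
  rw [L2.inner_def, L2.inner_def]
  exact (h.comp (measurable_fst.inner measurable_snd)).integral_eq

theorem IsAtomless.exists_Lp_identDistrib_norm_sub_le [CompleteSpace E] [IsFiniteMeasure P]
    (hP : IsAtomless P) {X G : Lp E p P} {X' G' Y' : Lp E p P'}
    (h : IdentDistrib (fun ω => (X ω, G ω)) (fun ω => (X' ω, G' ω)) P P') {ε : ℝ} (hε : 0 < ε) :
    ∃ X₁ G₁ Y₁ : Lp E p P,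
      IdentDistrib (fun ω => (X₁ ω, G₁ ω, Y₁ ω)) (fun ω => (X' ω, G' ω, Y' ω)) P P' ∧
      ‖X₁ - X‖ ≤ ε ∧ ‖G₁ - G‖ ≤ ε := by
  set C : ℝ := measureUnivNNReal P ^ p.toReal⁻¹
  have hC : 0 < C + 1 := by positivity
  obtain ⟨Z, Y, -, -, hid, hdist⟩ := hP.exists_identDistrib_dist_le
    ((measurable_Lp_coeFn X).prodMk (measurable_Lp_coeFn G))
    ((measurable_Lp_coeFn X').prodMk (measurable_Lp_coeFn G')) (measurable_Lp_coeFn Y') h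
    (div_pos hε hC)
  have hX₁ : MemLp (fun ω => (Z ω).1) p P :=
    (hid.comp (measurable_fst.comp measurable_fst)).symm.memLp_snd (Lp.memLp X')
  have hG₁ : MemLp (fun ω => (Z ω).2) p P :=
    (hid.comp (measurable_snd.comp measurable_fst)).symm.memLp_snd (Lp.memLp G')
  have hY₁ : MemLp Y p P := (hid.comp measurable_snd).symm.memLp_snd (Lp.memLp Y')
  have hle {A B : Lp E p P} (hAB : ∀ᵐ ω ∂P, dist (A ω) (B ω) ≤ ε / (C + 1)) : ‖A - B‖ ≤ ε := by
    refine (norm_sub_le_of_ae_dist_le (div_pos hε hC).le hAB).trans ?_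
    rw [mul_div_left_comm]
    exact mul_le_of_le_one_right hε.le ((div_le_one hC).2 (lt_add_one C).le)
  refine ⟨hX₁.toLp, hG₁.toLp, hY₁.toLp, ?_, hle ?_, hle ?_⟩
  · refine (IdentDistrib.of_ae_eq (by fun_prop) (hX₁.coeFn_toLp.prodMk
      (hG₁.coeFn_toLp.prodMk hY₁.coeFn_toLp))).trans ?_
    exact hid.comp (u := fun z : (E × E) × E => (z.1.1, z.1.2, z.2)) (by fun_prop)
  · filter_upwards [hX₁.coeFn_toLp, hdist] with ω hX hω
    exact hX ▸ (le_max_left _ _).trans hω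
  · filter_upwards [hG₁.coeFn_toLp, hdist] with ω hG hω
    exact hG ▸ (le_max_right _ _).trans hω

end Lp

section Independence

theorem ae_eq_integral_of_ae_prod_eq {E : Type*} [NormedAddCommGroup E] [NormedSpace ℝ E]
    [CompleteSpace E] [MeasurableSpace E] {ν : Measure E} [IsProbabilityMeasure ν]
    (h : ∀ᵐ p ∂ν.prod ν, p.1 = p.2) : ∀ᵐ y ∂ν, y = ∫ z, z ∂ν := by
  filter_upwards [Measure.ae_ae_of_ae_prod h] with y hy
  rw [← integral_congr_ae hy, integral_const, probReal_univ, one_smul]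

variable {Ω α E : Type*} [MeasurableSpace Ω] {P : Measure Ω} [IsFiniteMeasure P]
  [MeasurableSpace α] [NormedAddCommGroup E] [NormedSpace ℝ E] [CompleteSpace E]
  [SecondCountableTopology E] [MeasurableSpace E] [BorelSpace E]

theorem ae_eq_integral_of_ae_compProd_prod_eq {μ : Measure α} [SFinite μ] {κ : Kernel α E}
    [IsMarkovKernel κ] (h : ∀ᵐ p ∂μ ⊗ₘ (κ ×ₖ κ), p.2.1 = p.2.2) :
    ∀ᵐ p ∂μ ⊗ₘ κ, p.2 = ∫ z, z ∂κ p.1 := by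
  have hmeas : Measurable (fun x => ∫ z, z ∂κ x) :=
    stronglyMeasurable_id.integral_kernel.measurable
  refine (Measure.ae_compProd_iff (measurableSet_eq_fun measurable_snd
    (hmeas.comp measurable_fst))).2 ?_
  filter_upwards [Measure.ae_ae_of_ae_compProd h] with x hx
  rw [Kernel.prod_apply] at hx
  exact ae_eq_integral_of_ae_prod_eq hx

theorem IsAtomless.exists_ae_eq_comp (hP : IsAtomless P) [StandardBorelSpace α] [Nonempty α]
    {X : Ω → α} {Y : Ω → E} (hX : Measurable X) (hY : Measurable Y)
    (h : ∀ (X' : Ω → α) (Y₁ Y₂ : Ω → E),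
      IdentDistrib (fun ω => (X' ω, Y₁ ω)) (fun ω => (X ω, Y ω)) P P →
      IdentDistrib (fun ω => (X' ω, Y₂ ω)) (fun ω => (X ω, Y ω)) P P → Y₁ =ᵐ[P] Y₂) :
    ∃ g : α → E, Measurable g ∧ Y =ᵐ[P] fun ω => g (X ω) := by
  let κ := condDistrib Y X P
  have hκ : P.map X ⊗ₘ κ = P.map fun ω => (X ω, Y ω) := compProd_map_condDistrib hY.aemeasurable
  obtain ⟨Z, hZ, hZκ⟩ := hP.exists_map_eq (ν := P.map X ⊗ₘ (κ ×ₖ κ)) (by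
    rw [Measure.compProd_apply_univ, Measure.map_apply hX .univ, Set.preimage_univ])
  have hid {f : E × E → E} (hf : Measurable f) (hfκ : (κ ×ₖ κ).map f = κ) :
      IdentDistrib (fun ω => ((Z ω).1, f (Z ω).2)) (fun ω => (X ω, Y ω)) P P := by
    refine ⟨by fun_prop, by fun_prop, ?_⟩
    rw [← hκ, ← hfκ, Measure.compProd_map hf, ← hZκ, Measure.map_map (by fun_prop) hZ]
    rfl
  have heq : ∀ᵐ p ∂P.map X ⊗ₘ (κ ×ₖ κ), p.2.1 = p.2.2 := by
    rw [← hZκ, ae_map_iff hZ.aemeasurable (measurableSet_eq_fun (by fun_prop) (by fun_prop))]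
    exact h _ _ _ (hid measurable_fst ((Kernel.fst_eq _).symm.trans (Kernel.fst_prod κ κ)))
      (hid measurable_snd ((Kernel.snd_eq _).symm.trans (Kernel.snd_prod κ κ)))
  refine ⟨fun x => ∫ z, z ∂κ x, stronglyMeasurable_id.integral_kernel.measurable, ?_⟩
  have hfact := ae_eq_integral_of_ae_compProd_prod_eq heq
  rw [hκ] at hfact
  exact ae_of_ae_map (hX.prodMk hY).aemeasurable hfact

end Independence

section Gradient

open scoped Topology

theorem hasGradientAt_iff_forall_eventually_abs_sub_le {V : Type*} [NormedAddCommGroup V]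
    [InnerProductSpace ℝ V] [CompleteSpace V] {F : V → ℝ} {G X : V} :
    HasGradientAt F G X ↔
      ∀ c > 0, ∀ᶠ Y in 𝓝 0, |F (X + Y) - F X - inner ℝ G Y| ≤ c * ‖Y‖ := by
  rw [hasGradientAt_iff_hasFDerivAt, hasFDerivAt_iff_isLittleO_nhds_zero, Asymptotics.isLittleO_iff]
  rfl

theorem hasGradientAt_of_forall_exists_approx {V W : Type*} [NormedAddCommGroup V]
    [InnerProductSpace ℝ V] [CompleteSpace V] [NormedAddCommGroup W] [InnerProductSpace ℝ W]
    [CompleteSpace W] {F : V → ℝ} {F' : W → ℝ} {G X : V} {G' X' : W} (hG : HasGradientAt F G X)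
    (hX : F X = F' X')
    (h : ∀ Y' : W, ∀ ε > 0, ∃ X₁ G₁ Y₁ : V, ‖X₁ - X‖ ≤ ε ∧ ‖G₁ - G‖ ≤ ε ∧ ‖Y₁‖ = ‖Y'‖ ∧
      F (X₁ + Y₁) = F' (X' + Y') ∧ inner ℝ G₁ Y₁ = inner ℝ G' Y') :
    HasGradientAt F' G' X' := by
  rw [hasGradientAt_iff_forall_eventually_abs_sub_le] at hG ⊢
  intro c hc
  obtain ⟨δ, hδ, hF⟩ := Metric.eventually_nhds_iff_ball.1 (hG c hc)
  filter_upwards [Metric.ball_mem_nhds 0 hδ] with Y' hY'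
  have hle : ∀ᶠ ε in 𝓝[>] (0 : ℝ),
      |F' (X' + Y') - F' X' - inner ℝ G' Y'| ≤ c * (ε + ‖Y'‖) + ‖G‖ * ε + ε * ‖Y'‖ := by
    filter_upwards [Ioo_mem_nhdsGT (sub_pos.2 (mem_ball_zero_iff.1 hY'))] with ε hε
    obtain ⟨X₁, G₁, Y₁, hX₁, hG₁, hY₁, hF₁, hinner⟩ := h Y' ε hε.1
    have hW : ‖X₁ - X + Y₁‖ ≤ ε + ‖Y'‖ := (norm_add_le _ _).trans (add_le_add hX₁ hY₁.le)
    have hFW := hF _ (mem_ball_zero_iff.2 (hW.trans_lt (lt_sub_iff_add_lt.1 hε.2)))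
    calc |F' (X' + Y') - F' X' - inner ℝ G' Y'|
        = |(F (X + (X₁ - X + Y₁)) - F X - inner ℝ G (X₁ - X + Y₁)) + inner ℝ G (X₁ - X)
            - inner ℝ (G₁ - G) Y₁| := by
          rw [← hF₁, ← hX, ← hinner, inner_add_right, inner_sub_left, ← add_assoc,
            add_sub_cancel]
          ring_nf
      _ ≤ c * ‖X₁ - X + Y₁‖ + ‖G‖ * ‖X₁ - X‖ + ‖G₁ - G‖ * ‖Y₁‖ :=
          (abs_sub _ _).trans (add_le_add ((abs_add_le _ _).trans
            (add_le_add hFW (abs_real_inner_le_norm _ _))) (abs_real_inner_le_norm _ _))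
      _ ≤ c * (ε + ‖Y'‖) + ‖G‖ * ε + ε * ‖Y'‖ := by rw [hY₁]; gcongr
  -- The estimate holds for every small `ε` with `Y'` fixed, so `ε` may be sent to `0`.
  have hlim : Filter.Tendsto (fun ε : ℝ => c * (ε + ‖Y'‖) + ‖G‖ * ε + ε * ‖Y'‖)
      (𝓝[>] 0) (𝓝 (c * ‖Y'‖)) :=
    tendsto_nhdsWithin_of_tendsto_nhds (Continuous.tendsto' (by fun_prop) _ _ (by simp))
  exact ge_of_tendsto hlim hle

variable {Ω : Type*} [MeasurableSpace Ω] {P : Measure Ω} [IsFiniteMeasure P] {E : Type*}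
  [NormedAddCommGroup E] [InnerProductSpace ℝ E] [CompleteSpace E] [SecondCountableTopology E]
  [MeasurableSpace E] [BorelSpace E]

theorem IsAtomless.hasGradientAt_of_identDistrib (hP : IsAtomless P) {F : Lp E 2 P → ℝ}
    (hF : ∀ X Y : Lp E 2 P, IdentDistrib X Y P P → F X = F Y) {X X' G G' : Lp E 2 P}
    (hG : HasGradientAt F G X)
    (h : IdentDistrib (fun ω => (X ω, G ω)) (fun ω => (X' ω, G' ω)) P P) :
    HasGradientAt F G' X' := by
  refine hasGradientAt_of_forall_exists_approx hG (hF X X' (h.comp measurable_fst))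
    fun Y' ε hε => ?_
  obtain ⟨X₁, G₁, Y₁, hid, hX₁, hG₁⟩ := hP.exists_Lp_identDistrib_norm_sub_le h (Y' := Y') hε
  exact ⟨X₁, G₁, Y₁, hX₁, hG₁,
    norm_eq_of_identDistrib (hid.comp (measurable_snd.comp measurable_snd)),
    hF _ _ (identDistrib_add (hid.comp (measurable_fst.prodMk
      (measurable_snd.comp measurable_snd)))),
    inner_eq_of_identDistrib (hid.comp measurable_snd)⟩

theorem IsAtomless.exists_gradient_ae_eq_comp (hP : IsAtomless P) {F : Lp E 2 P → ℝ}
    (hF : ∀ X Y : Lp E 2 P, IdentDistrib X Y P P → F X = F Y) {X G : Lp E 2 P}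
    (hG : HasGradientAt F G X) : ∃ g : E → E, Measurable g ∧ G =ᵐ[P] fun ω => g (X ω) := by
  refine hP.exists_ae_eq_comp (measurable_Lp_coeFn X) (measurable_Lp_coeFn G)
    fun X' Y₁ Y₂ h₁ h₂ => ?_
  have hX' : MemLp X' 2 P := (h₁.comp measurable_fst).symm.memLp_snd (Lp.memLp X)
  have hgrad {Y : Ω → E} (hY : MemLp Y 2 P)
      (h : IdentDistrib (fun ω => (X' ω, Y ω)) (fun ω => (X ω, G ω)) P P) :
      HasGradientAt F (hY.toLp Y) (hX'.toLp X') :=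
    hP.hasGradientAt_of_identDistrib hF hG (h.symm.trans (identDistrib_toLp_prodMk hX' hY))
  have hY₁ : MemLp Y₁ 2 P := (h₁.comp measurable_snd).symm.memLp_snd (Lp.memLp G)
  have hY₂ : MemLp Y₂ 2 P := (h₂.comp measurable_snd).symm.memLp_snd (Lp.memLp G)
  exact (MemLp.toLp_eq_toLp_iff hY₁ hY₂).1 ((hgrad hY₁ h₁).unique (hgrad hY₂ h₂))

end Gradient

theorem lemma4_general {Ω : Type*} [MeasurableSpace Ω] (P : Measure Ω) [IsFiniteMeasure P]
    (hP : IsAtomless P) {E : Type*} [NormedAddCommGroup E] [InnerProductSpace ℝ E]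
    [CompleteSpace E] [SecondCountableTopology E] [MeasurableSpace E] [BorelSpace E]
    (F : Lp E 2 P → ℝ) (hF : ∀ X Y : Lp E 2 P, IdentDistrib X Y P P → F X = F Y)
    (μ : Measure E) (X : Lp E 2 P) (hX : HasLaw X μ P) (hdiff : DifferentiableAt ℝ F X) :
    ∃ g : E → E, Measurable g ∧ MemLp g 2 μ ∧ ((∇ F X : Lp E 2 P) =ᵐ[P] fun ω => g (X ω)) ∧
      ∀ X' : Lp E 2 P, HasLaw X' μ P →
        DifferentiableAt ℝ F X' ∧ ((∇ F X' : Lp E 2 P) =ᵐ[P] fun ω => g (X' ω)) := by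
  have hG := hdiff.hasGradientAt
  obtain ⟨g, hg, hgX⟩ := hP.exists_gradient_ae_eq_comp hF hG
  have hmemLp {X' : Lp E 2 P} (hX' : HasLaw X' μ P) :
      MemLp g 2 μ ↔ MemLp (fun ω => g (X' ω)) 2 P := by
    rw [← hX'.map_eq]
    exact memLp_map_measure_iff hg.aestronglyMeasurable hX'.aemeasurable
  have hgμ : MemLp g 2 μ := (hmemLp hX).2 ((Lp.memLp (∇ F X)).ae_eq hgX)
  refine ⟨g, hg, hgμ, hgX, fun X' hX' => ?_⟩
  have hgX' := (hmemLp hX').1 hgμ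
  have hid : IdentDistrib (fun ω => (X ω, ∇ F X ω)) (fun ω => (X' ω, hgX'.toLp _ ω)) P P := by
    refine .trans (.of_ae_eq ?_ (.prodMk .rfl hgX)) <|
      ((hX.identDistrib hX').comp (measurable_id.prodMk hg)).trans <|
      .of_ae_eq ?_ (.prodMk .rfl hgX'.coeFn_toLp.symm)
    all_goals fun_prop
  have hG' := hP.hasGradientAt_of_identDistrib hF hG hid
  exact ⟨hG'.differentiableAt, hG'.gradient ▸ hgX'.coeFn_toLp⟩

theorem lemma4 {Ω : Type*} [MeasurableSpace Ω] (P : Measure Ω) [IsProbabilityMeasure P]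
    (hP : IsAtomless P) (d : ℕ)
    (F : Lp (EuclideanSpace ℝ (Fin d)) 2 P → ℝ) (hF : LawInvariant F)
    (μ : Measure (EuclideanSpace ℝ (Fin d)))
    (X : Lp (EuclideanSpace ℝ (Fin d)) 2 P) (hX : HasLaw X μ P)
    (hdiff : DifferentiableAt ℝ F X) :
    ∃ g : EuclideanSpace ℝ (Fin d) → EuclideanSpace ℝ (Fin d),
      Measurable g ∧ MemLp g 2 μ ∧
      ((∇ F X : Lp (EuclideanSpace ℝ (Fin d)) 2 P) =ᵐ[P] fun ω => g (X ω)) ∧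
      ∀ X' : Lp (EuclideanSpace ℝ (Fin d)) 2 P, HasLaw X' μ P →
        DifferentiableAt ℝ F X' ∧ ((∇ F X' : Lp (EuclideanSpace ℝ (Fin d)) 2 P) =ᵐ[P] fun ω => g (X' ω)) :=
  lemma4_general P hP F hF μ X hX hdiff
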